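/- **Setting.** Fix a one-parameter exponential family of distributions on $\mathbb{R}$: the distributions $\nu_\theta$ with density $x\mapsto e^{\theta x-A(\theta)}$ with respect to a reference measure $\rho$ that is not concentrated at a point, where $\theta$ ranges over a nonempty open interval $\Theta$ on which $e^{A(\theta)}=\int e^{\theta x}\,\rho(dx)<\infty$ (for example the Bernoulli or the Poisson distributions). Parametrize its members by their means, let $I$ be the set of these means, and let $d(a,b)$ be the Kullback–Leibler divergence between the members with means $a,b\in I$. Let $d_B(a,b)$ be the Kullback–Leibler divergence between the Bernoulli distributions with parameters $a$ and $b$. There are $K\ge 1$ slices with loads $\mu=(\mu_1,\dots,\mu_K)$ and a threshold $\gamma\in I$; write $\mu_\star=\min_k\mu_k$. Let $\mathcal{M}=\{\mu\in I^K:\mu_\star\ne\gamma\}$. Under $\mathbb{P}_\mu$, the measurements $X_k(t)$ ($k\in[K]$, $t\ge1$) are independent and $X_k(t)$ has the law of the family with mean $\mu_k$. An algorithm consists of the probed slices $k_t$, where $k_t$ is $\mathcal{F}_{t-1}$-measurable and $\mathcal{F}_t=\sigma(k_1,X_{k_1}(1),\dots,k_t,X_{k_t}(t))$, of a stopping time $\tau$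 of $(\mathcal{F}_t)_{t\ge 0}$, and of an $\mathcal{F}_\tau$-measurable decision $\hat{k}\in\{0,1,\dots,K\}$ ($0$ means rejection). Under the any-available-slice criterion the set of correct decisions is $\mathcal{C}(\mu)=\{k:\mu_k<\gamma\}$ if $\mu_\star<\gamma$, and $\mathcal{C}(\mu)=\{0\}$ otherwise. The algorithm is $\delta$-PC if $\mathbb{P}_\mu[\tau<\infty]=1$ and $\mathbb{P}_\mu[\hat{k}\notin\mathcal{C}(\mu)]\le\delta$ for every $\mu\in\mathcal{M}$. Let $\Lambda=\{w\in[0,1]^K:\sum_k w_k=1\}$ and, for $w\in\Lambda$, $$V_\mu(w)=\max_{\ell\in\mathcal{C}(\mu)}\ \inf_{\lambda\in\mathcal{M}:\,\ell\notin\mathcal{C}(\lambda)}\ \sum_{k=1}^K w_k\,d(\mu_k,\lambda_k).$$ The optimal measurement processes are the maximizers of $V_\mu$ over $\Lambda$. **Proposition.** Let $0<\delta\le 1/2$ and let $\mu\in\mathcal{M}$ with $\mathcal{C}(\mu)\ne\{0\}$. Then: 1. every $\delta$-PC algorithm satisfies $\mathbb{E}_\mu[\tau]\ \ge\ T_1(\mu)\,d_B(\delta,1-\delta)$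 with $T_1(\mu)=d(\mu_\star,\gamma)^{-1}$ (where $\mathbb{E}_\mu[\tau]$ may be infinite); 2. $\max_{w\in\Lambda}V_\mu(w)=d(\mu_\star,\gamma)=T_1(\mu)^{-1}$; 3. the maximizers of $V_\mu$ over $\Lambda$ are exactly the vectors $w^\star$ with $w^\star_k=\mathbb{1}_{(k=k_\star)}$ for all $k$, where $k_\star\in\arg\min_k\mu_k$ is a least loaded slice; that is, the optimal measurement process samples a single slice only, a least loaded one. -/

import Mathlib

open MeasureTheory ProbabilityTheory InformationTheory
open scoped ENNReal

noncomputable section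

namespace Admission

/-- A one-parameter (canonical) exponential family of distributions on the real line: the
distributions with density `x ↦ exp (θ * x - A θ)` with respect to a fixed reference measure `ref`,
for natural parameters `θ` in a nonempty open interval `Θ`, where `exp (A θ) = ∫ exp (θ * x)` is
finite on `Θ`. The reference measure is not concentrated at a point. -/
structure ExpFamily where
  /-- the reference measure -/
  ref : Measure ℝ
  /-- the open interval of natural parameters -/
  Θ : Set ℝ
  isOpen_Θ : IsOpen Θ
  ordConnected_Θ : Θ.OrdConnected
  nonempty_Θ : Θ.Nonempty
  integrable_exp : ∀ θ ∈ Θ, Integrable (fun x : ℝ => Real.exp (θ * x)) ref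
  nondegenerate : ∀ c : ℝ, ¬ ∀ᵐ x ∂ref, x = c

namespace ExpFamily

variable (F : ExpFamily)

instance : Nonempty F.Θ := F.nonempty_Θ.to_subtype

/-- The member of the family with natural parameter `θ`, i.e. the probability measure with density
`exp (θ * x) / ∫ exp (θ * y) d(ref)` with respect to `ref`. -/
def member (θ : ℝ) : Measure ℝ := F.ref.tilted (fun x => θ * x)

/-- The mean of the member with natural parameter `θ`. -/
def mean (θ : ℝ) : ℝ := ∫ x, x ∂(F.member θ)

/-- The set of means of the members of the family. -/
def means : Set ℝ := F.mean '' F.Θ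

/-- The natural parameter of the member with mean `m` (meaningful for `m ∈ F.means`). -/
def naturalParam (m : ℝ) : F.Θ := Function.invFun (fun θ : F.Θ => F.mean θ) m

/-- The member of the family with mean `m` (meaningful for `m ∈ F.means`). -/
def law (m : ℝ) : Measure ℝ := F.member (F.naturalParam m)

/-- `d a b`: the Kullback-Leibler divergence between the members with means `a` and `b`. -/
def d (a b : ℝ) : ℝ≥0∞ := klDiv (F.law a) (F.law b)

instance isProbabilityMeasure_law (m : ℝ) : IsProbabilityMeasure (F.law m) := by
  have : NeZero F.ref := ⟨fun h => F.nondegenerate 0 (by simp [h])⟩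
  exact isProbabilityMeasure_tilted (F.integrable_exp _ (F.naturalParam m).2)

end ExpFamily

/-- `dB a b`: the Kullback-Leibler divergence between the Bernoulli distributions with
parameters `a` and `b`. -/
def dB (a b : unitInterval) : ℝ≥0∞ :=
  klDiv (bernoulliMeasure (1 : ℕ) 0 a) (bernoulliMeasure (1 : ℕ) 0 b)

/-- The outcomes: `ω (t, k)` is the measurement `X_k(t + 1)` that slice `k` would give in
slot `t + 1`. -/
abbrev Outcome (K : ℕ) : Type := ℕ × Fin K → ℝ

/-- `P_μ`: all measurements are independent, and those of slice `k` have the law of the family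
with mean `μ k`. -/
def traffic (F : ExpFamily) {K : ℕ} (μ : Fin K → ℝ) : Measure (Outcome K) :=
  Measure.infinitePi (fun p : ℕ × Fin K => F.law (μ p.2))

/-- The `σ`-algebra `ℱ_t` generated by the first `t` probed slices and the corresponding `t`
measurements, where `k s` is the slice probed in slot `s + 1`. -/
@[reducible] def obsSigma {K : ℕ} (k : ℕ → Outcome K → Fin K) (t : ℕ) : MeasurableSpace (Outcome K) :=
  ⨆ s : ℕ, ⨆ _ : s < t,
    MeasurableSpace.comap (fun ω : Outcome K => (k s ω, ω (s, k s ω))) inferInstance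

/-- A sampling strategy: `slice t` is the slice probed in slot `t + 1`; it depends on the
observations of the first `t` slots only. -/
structure SamplingRule (K : ℕ) where
  /-- the slice probed in slot `t + 1` -/
  slice : ℕ → Outcome K → Fin K
  measurable_slice : ∀ t, Measurable[obsSigma slice t] (slice t)

namespace SamplingRule

variable {K : ℕ} (S : SamplingRule K)

lemma obsSigma_le (t : ℕ) : obsSigma S.slice t ≤ MeasurableSpace.pi := by
  induction t using Nat.strong_induction_on with
  | _ t ih =>
    refine iSup_le fun s => iSup_le fun hs => ?_
    have hk : Measurable (S.slice s) := (S.measurable_slice s).mono (ih s hs) le_rfl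
    refine Measurable.comap_le (hk.prodMk ?_)
    have h : Measurable (fun p : Fin K × Outcome K => p.2 (s, p.1)) :=
      measurable_from_prod_countable_right fun a => measurable_pi_apply (s, a)
    exact h.comp (hk.prodMk measurable_id)

/-- The filtration of the observations. -/
def filtration : Filtration ℕ (MeasurableSpace.pi : MeasurableSpace (Outcome K)) where
  seq := obsSigma S.slice
  mono' := fun _ _ h =>
    iSup_mono fun _ => iSup_mono' fun hs => ⟨lt_of_lt_of_le hs h, le_rfl⟩
  le' := S.obsSigma_le

end SamplingRule

/-- A joint measurement and decision algorithm: a sampling strategy, a stopping rule `τ` (a stopping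
time of the observation filtration; `τ` is the number of measurements made) and a decision rule
that depends on the observations up to `τ`. The decision `0` is rejection, and the decision
`k.succ` is admission on slice `k`. -/
structure Algorithm (K : ℕ) extends SamplingRule K where
  /-- the number of measurements made -/
  τ : Outcome K → ℕ∞
  isStoppingTime_τ : IsStoppingTime toSamplingRule.filtration τ
  /-- the decision -/
  decision : Outcome K → Fin (K + 1)
  measurable_decision : Measurable[isStoppingTime_τ.measurableSpace] decision

/-- The smallest load `μ_⋆`. -/
def minLoad {K : ℕ} [NeZero K] (μ : Fin K → ℝ) : ℝ := Finset.univ.inf' Finset.univ_nonempty μ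

/-- The correct decisions under the any-available-slice criterion: the available slices if there is
one, and rejection otherwise. -/
def correct {K : ℕ} [NeZero K] (γ : ℝ) (μ : Fin K → ℝ) : Set (Fin (K + 1)) :=
  {a | (minLoad μ < γ ∧ ∃ k : Fin K, a = k.succ ∧ μ k < γ) ∨ (¬ minLoad μ < γ ∧ a = 0)}

/-- The load vectors under consideration: all loads are means of the family, and the smallest load
is not equal to the threshold. -/
def instances (F : ExpFamily) (K : ℕ) [NeZero K] (γ : ℝ) : Set (Fin K → ℝ) :=
  {μ | (∀ k, μ k ∈ F.means) ∧ minLoad μ ≠ γ}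

/-- `δ`-PC algorithms for the any-available-slice criterion: for every load vector, the algorithm
stops almost surely, and its decision is wrong with probability at most `δ`. -/
def Algorithm.IsPC {K : ℕ} [NeZero K] (A : Algorithm K) (F : ExpFamily) (γ δ : ℝ) : Prop :=
  ∀ μ ∈ instances F K γ,
    (∀ᵐ ω ∂(traffic F μ), A.τ ω < ⊤) ∧
    traffic F μ {ω | A.decision ω ∉ correct γ μ} ≤ ENNReal.ofReal δ

/-- The expected number of measurements `E_μ[τ]`. -/
def Algorithm.expectedCost {K : ℕ} (A : Algorithm K) (F : ExpFamily) (μ : Fin K → ℝ) : ℝ≥0∞ :=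
  ∫⁻ ω, (A.τ ω : ℝ≥0∞) ∂(traffic F μ)

/-- The information `∑_k w_k d(μ_k, λ_k)` that proportions `w` give for distinguishing the load
vector `μ` from `l`. -/
def information (F : ExpFamily) {K : ℕ} (w μ l : Fin K → ℝ) : ℝ≥0∞ :=
  ∑ k, ENNReal.ofReal (w k) * F.d (μ k) (l k)

/-- `max_{a ∈ C(μ)} inf_{λ : a ∉ C(λ)} ∑_k w_k d(μ_k, λ_k)`: the objective that the optimal
measurement proportions maximize over the simplex. -/
def objective (F : ExpFamily) {K : ℕ} [NeZero K] (γ : ℝ) (μ w : Fin K → ℝ) : ℝ≥0∞ :=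
  ⨆ a ∈ correct γ μ, ⨅ l ∈ {l ∈ instances F K γ | a ∉ correct γ l}, information F w μ l

/-- The value of the max-min problem: the supremum of the objective over the simplex. -/
def maxMinValue (F : ExpFamily) {K : ℕ} [NeZero K] (γ : ℝ) (μ : Fin K → ℝ) : ℝ≥0∞ :=
  ⨆ w ∈ stdSimplex ℝ (Fin K), objective F γ μ w

/-- The optimal measurement processes: the maximizers, over the simplex of proportions, of the
objective. -/
def optimalProportions (F : ExpFamily) {K : ℕ} [NeZero K] (γ : ℝ) (μ : Fin K → ℝ) :
    Set (Fin K → ℝ) :=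
  {w | w ∈ stdSimplex ℝ (Fin K) ∧ IsMaxOn (objective F γ μ) (stdSimplex ℝ (Fin K)) w}

end Admission

end

/-! The lower bound is a change of measure. Given a mean `b > γ`, raise every load to `max (μ k) b`.
Rejection is then the correct decision and has probability at least `1 - δ`, whereas under `μ` it is
an error and has probability at most `δ`. Each probe contributes at most `d(μ_⋆, b)` to the expected
log-likelihood ratio, since `d(·, b)` decreases below `b` and raising a load that is at least `b`
costs nothing. Wald's inequality (`integral_stoppedSum_le`) bounds the expected ratio by `d(μ_⋆, b)
E[τ]`, and a variational bound (`le_integral_stoppedSum`) shows that telling the two models apart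
requires at least `d_B(δ, 1 - δ)`. Letting `b` decrease to `γ` gives the claim. The detour through
`b` is needed because a smallest load equal to `γ` is excluded.

For the max-min problem, the cheapest way to make an available slice `k` unavailable is to raise its
load just above `γ`, at cost `w k * d(μ k, γ)` (`iInf_information_eq`). The objective is therefore
the maximum of these products over the available slices. It is at most `d(μ_⋆, γ)`, with equality
only if some least loaded slice has weight one.

Both halves rest on monotonicity and continuity of `d`, which is the Bregman divergence of the
strictly convex cumulant generating function. -/

namespace Admission

open Filter Topology Set

/-! ### Divergences in a one-parameter exponential family -/

namespace ExpFamily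

variable (F : ExpFamily)

lemma subset_interior_integrableExpSet : F.Θ ⊆ interior (integrableExpSet id F.ref) :=
  interior_maximal (fun θ hθ => F.integrable_exp θ hθ) F.isOpen_Θ

lemma ref_ne_zero : F.ref ≠ 0 := fun h => F.nondegenerate 0 (by simp [h])

instance : NeZero F.ref := ⟨F.ref_ne_zero⟩

lemma isProbabilityMeasure_member {θ : ℝ} (hθ : θ ∈ F.Θ) : IsProbabilityMeasure (F.member θ) :=
  isProbabilityMeasure_tilted (F.integrable_exp θ hθ)

lemma mean_eq_deriv_cgf {θ : ℝ} (hθ : θ ∈ F.Θ) : F.mean θ = deriv (cgf id F.ref) θ :=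
  integral_tilted_mul_self (X := id) (F.subset_interior_integrableExpSet hθ)

lemma memLp_two_member {θ : ℝ} (hθ : θ ∈ F.Θ) : MemLp (id : ℝ → ℝ) 2 (F.member θ) :=
  memLp_tilted_mul (X := id) (F.subset_interior_integrableExpSet hθ) 2

lemma integrable_id_member {θ : ℝ} (hθ : θ ∈ F.Θ) : Integrable (fun x : ℝ => x) (F.member θ) :=
  haveI := F.isProbabilityMeasure_member hθ
  (F.memLp_two_member hθ).integrable (by norm_num)

/-- Zero variance would concentrate the member at a point, and hence also the reference measure,
which is absolutely continuous with respect to each member. -/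
lemma variance_member_pos {θ : ℝ} (hθ : θ ∈ F.Θ) : 0 < Var[id; F.member θ] := by
  have := F.isProbabilityMeasure_member hθ
  refine lt_of_le_of_ne (variance_nonneg _ _) fun h => ?_
  have h0 : evariance id (F.member θ) = 0 := by
    rw [← (F.memLp_two_member hθ).ofReal_variance_eq, ← h, ENNReal.ofReal_zero]
  rw [evariance_eq_zero_iff measurable_id.aemeasurable] at h0
  exact F.nondegenerate _ ((absolutelyContinuous_tilted (F.integrable_exp θ hθ)).ae_le h0)

lemma interior_Θ : interior F.Θ = F.Θ := F.isOpen_Θ.interior_eq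

lemma convex_Θ : Convex ℝ F.Θ := F.ordConnected_Θ.convex

lemma differentiableAt_cgf {θ : ℝ} (hθ : θ ∈ F.Θ) : DifferentiableAt ℝ (cgf id F.ref) θ :=
  (analyticAt_cgf (F.subset_interior_integrableExpSet hθ)).differentiableAt

/-- The mean is the first derivative of the cumulant generating function, and the second derivative
is the variance, which is positive. -/
lemma strictMonoOn_mean : StrictMonoOn F.mean F.Θ := by
  have h : StrictMonoOn (deriv (cgf id F.ref)) F.Θ := by
    refine strictMonoOn_of_deriv_pos F.convex_Θ (fun θ hθ => ?_) (fun θ hθ => ?_)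
    · exact (analyticAt_cgf (F.subset_interior_integrableExpSet hθ)).deriv.continuousAt
        |>.continuousWithinAt
    · rw [interior_Θ] at hθ
      have := variance_tilted_mul (X := id) (F.subset_interior_integrableExpSet hθ)
      rw [iteratedDeriv_succ, iteratedDeriv_one] at this
      rw [← this]
      exact F.variance_member_pos hθ
  intro a ha b hb hab
  rw [F.mean_eq_deriv_cgf ha, F.mean_eq_deriv_cgf hb]
  exact h ha hb hab

lemma naturalParam_mean {θ : ℝ} (hθ : θ ∈ F.Θ) : (F.naturalParam (F.mean θ) : ℝ) = θ :=
  congrArg Subtype.val (Function.leftInverse_invFun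
    (f := fun θ : F.Θ => F.mean θ) (F.strictMonoOn_mean.injOn.injective) ⟨θ, hθ⟩)

lemma mean_naturalParam {m : ℝ} (hm : m ∈ F.means) : F.mean (F.naturalParam m) = m := by
  obtain ⟨θ, hθ, rfl⟩ := hm
  rw [F.naturalParam_mean hθ]

lemma naturalParam_lt_iff {a b : ℝ} (ha : a ∈ F.means) (hb : b ∈ F.means) :
    (F.naturalParam a : ℝ) < F.naturalParam b ↔ a < b := by
  rw [← F.strictMonoOn_mean.lt_iff_lt (F.naturalParam a).2 (F.naturalParam b).2,
    F.mean_naturalParam ha, F.mean_naturalParam hb]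

lemma naturalParam_le_iff {a b : ℝ} (ha : a ∈ F.means) (hb : b ∈ F.means) :
    (F.naturalParam a : ℝ) ≤ F.naturalParam b ↔ a ≤ b := by
  rw [← not_lt, F.naturalParam_lt_iff hb ha, not_lt]

/-- The real-valued Kullback-Leibler divergence between the members with natural parameters
`s` and `t`. -/
noncomputable def kl (s t : ℝ) : ℝ := cgf id F.ref t - cgf id F.ref s - (t - s) * F.mean s

/-- The log-likelihood ratio between the members with natural parameters `s` and `t`. -/
noncomputable def logRatio (s t x : ℝ) : ℝ := cgf id F.ref t - cgf id F.ref s - (t - s) * x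

lemma measurable_logRatio (s t : ℝ) : Measurable (F.logRatio s t) := by
  unfold logRatio; fun_prop

lemma integrable_logRatio {s : ℝ} (hs : s ∈ F.Θ) (t : ℝ) :
    Integrable (F.logRatio s t) (F.member s) :=
  haveI := F.isProbabilityMeasure_member hs
  (integrable_const _).sub ((F.integrable_id_member hs).const_mul _)

lemma integral_logRatio {s : ℝ} (hs : s ∈ F.Θ) (t : ℝ) :
    ∫ x, F.logRatio s t x ∂(F.member s) = F.kl s t := by
  have := F.isProbabilityMeasure_member hs
  unfold logRatio kl
  rw [integral_sub (integrable_const _) ((F.integrable_id_member hs).const_mul _),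
    integral_const_mul]
  simp [mean]

lemma member_tilted {s : ℝ} (hs : s ∈ F.Θ) (t : ℝ) :
    (F.member s).tilted (fun x => (t - s) * x) = F.member t := by
  unfold member
  rw [tilted_tilted (F.integrable_exp s hs)]
  congr 1
  ext x
  simp only [Pi.add_apply]
  ring

lemma integrable_exp_sub_mul {s t : ℝ} (hs : s ∈ F.Θ) (ht : t ∈ F.Θ) :
    Integrable (fun x => Real.exp ((t - s) * x)) (F.member s) := by
  unfold member
  rw [integrable_tilted_iff (F.integrable_exp s hs)]
  refine (F.integrable_exp t ht).congr (ae_of_all _ fun x => ?_)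
  simp only [smul_eq_mul, ← Real.exp_add]
  ring_nf

lemma integral_exp_sub_mul {s t : ℝ} (hs : s ∈ F.Θ) (ht : t ∈ F.Θ) :
    ∫ x, Real.exp ((t - s) * x) ∂(F.member s)
      = Real.exp (cgf id F.ref t - cgf id F.ref s) := by
  unfold member
  rw [integral_exp_tilted, Real.exp_sub, exp_cgf (X := id) (F.integrable_exp t ht),
    exp_cgf (X := id) (F.integrable_exp s hs), mgf, mgf]
  congr 3
  ext x
  simp only [Pi.add_apply, id]
  ring_nf

/-- The ratio has the member at `s` in the numerator, hence the minus sign. This is the form in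
which the change of measure takes its hypothesis `hν`. -/
lemma member_eq_withDensity {s t : ℝ} (hs : s ∈ F.Θ) (ht : t ∈ F.Θ) :
    F.member t
      = (F.member s).withDensity (fun x => ENNReal.ofReal (Real.exp (-F.logRatio s t x))) := by
  rw [← F.member_tilted hs t, Measure.tilted, F.integral_exp_sub_mul hs ht]
  simp only [← Real.exp_sub, logRatio]
  congr with x
  ring_nf

lemma klDiv_member {s t : ℝ} (hs : s ∈ F.Θ) (ht : t ∈ F.Θ) :
    klDiv (F.member s) (F.member t) = ENNReal.ofReal (F.kl s t) := by
  have := F.isProbabilityMeasure_member hs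
  have := F.isProbabilityMeasure_member ht
  have hinteg := F.integrable_exp_sub_mul hs ht
  have hf : Integrable (fun x => (t - s) * x) (F.member s) :=
    (F.integrable_id_member hs).const_mul _
  have hself : Integrable (llr (F.member s) (F.member s)) (F.member s) :=
    (integrable_zero _ _ _).congr (llr_self _).symm
  rw [← F.member_tilted hs t, klDiv_of_ac_of_integrable (absolutelyContinuous_tilted hinteg)
    (integrable_llr_tilted_right .rfl hf hself hinteg),
    integral_llr_tilted_right .rfl hf hinteg hself, F.member_tilted hs t,
    F.integral_exp_sub_mul hs ht, Real.log_exp, integral_congr_ae (llr_self _),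
    integral_const_mul]
  simp only [Pi.zero_apply, integral_zero, probReal_univ, kl, mean]
  congr 1
  ring

/-- `kl s t` is the height at `t` of the convex function `cgf` above its tangent at `s`. -/
lemma kl_nonneg {s t : ℝ} (hs : s ∈ F.Θ) (ht : t ∈ F.Θ) : 0 ≤ F.kl s t := by
  have hconv : ConvexOn ℝ F.Θ (cgf id F.ref) := by
    refine MonotoneOn.convexOn_of_deriv F.convex_Θ
      (fun θ hθ => (F.differentiableAt_cgf hθ).continuousAt.continuousWithinAt)
      (fun θ hθ => (F.differentiableAt_cgf (F.interior_Θ ▸ hθ)).differentiableWithinAt) ?_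
    rw [interior_Θ]
    intro a ha b hb hab
    rw [← F.mean_eq_deriv_cgf ha, ← F.mean_eq_deriv_cgf hb]
    exact F.strictMonoOn_mean.monotoneOn ha hb hab
  have hd := (F.differentiableAt_cgf hs).hasDerivAt
  rw [← F.mean_eq_deriv_cgf hs] at hd
  unfold kl
  rcases lt_trichotomy s t with h | rfl | h
  · have := hconv.le_slope_of_hasDerivAt hs ht h hd
    rw [slope_def_field, le_div_iff₀ (by linarith)] at this
    linarith
  · simp
  · have := hconv.slope_le_of_hasDerivAt ht hs h hd
    rw [slope_def_field, div_le_iff₀ (by linarith)] at this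
    linarith

lemma kl_self (s : ℝ) : F.kl s s = 0 := by simp [kl]

/-- Three-point identity of Bregman divergences: the difference is `kl s s'` plus a product of two
positive increments. -/
lemma kl_lt_kl_left {s s' u : ℝ} (hs : s ∈ F.Θ) (hs' : s' ∈ F.Θ) (h : s < s') (hu : s' < u) :
    F.kl s' u < F.kl s u := by
  have h1 := F.kl_nonneg hs hs'
  have h2 := F.strictMonoOn_mean hs hs' h
  have h3 : 0 < (u - s') * (F.mean s' - F.mean s) := mul_pos (by linarith) (by linarith)
  have h4 : F.kl s u - F.kl s' u = F.kl s s' + (u - s') * (F.mean s' - F.mean s) := by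
    unfold kl; ring
  linarith

lemma kl_le_kl_right {s t u : ℝ} (hs : s ∈ F.Θ) (ht : t ∈ F.Θ) (hu : u ∈ F.Θ) (h : s ≤ t)
    (htu : t ≤ u) : F.kl s t ≤ F.kl s u := by
  have h1 := F.kl_nonneg ht hu
  have h2 := F.strictMonoOn_mean.monotoneOn hs ht h
  have h3 : 0 ≤ (u - t) * (F.mean t - F.mean s) := mul_nonneg (by linarith) (by linarith)
  have h4 : F.kl s u - F.kl s t = F.kl t u + (u - t) * (F.mean t - F.mean s) := by
    unfold kl; ring
  linarith

lemma kl_pos {s t : ℝ} (hs : s ∈ F.Θ) (ht : t ∈ F.Θ) (h : s < t) : 0 < F.kl s t := by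
  -- Moving `s` to the midpoint strictly decreases the divergence, which is still nonnegative there.
  have hmem : (s + t) / 2 ∈ F.Θ :=
    F.ordConnected_Θ.out hs ht ⟨by linarith, by linarith⟩
  exact (F.kl_nonneg hmem ht).trans_lt
    (F.kl_lt_kl_left hs hmem (by linarith) (by linarith))

lemma continuousAt_kl_right (s : ℝ) {t : ℝ} (ht : t ∈ F.Θ) : ContinuousAt (F.kl s) t := by
  unfold kl
  exact ((F.differentiableAt_cgf ht).continuousAt.sub continuousAt_const).sub
    ((continuousAt_id.sub continuousAt_const).mul continuousAt_const)

lemma d_eq (a b : ℝ) : F.d a b = ENNReal.ofReal (F.kl (F.naturalParam a) (F.naturalParam b)) :=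
  F.klDiv_member (F.naturalParam a).2 (F.naturalParam b).2

@[simp]
lemma d_self (a : ℝ) : F.d a a = 0 := by simp [d_eq, kl_self]

lemma d_ne_top (a b : ℝ) : F.d a b ≠ ∞ := by simp [d_eq]

lemma d_pos {a b : ℝ} (ha : a ∈ F.means) (hb : b ∈ F.means) (h : a < b) : 0 < F.d a b := by
  rw [d_eq, ENNReal.ofReal_pos]
  exact F.kl_pos (Subtype.mem _) (Subtype.mem _) ((F.naturalParam_lt_iff ha hb).2 h)

lemma d_lt_d_left {a a' b : ℝ} (ha : a ∈ F.means) (ha' : a' ∈ F.means) (hb : b ∈ F.means)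
    (h : a < a') (hab : a' < b) : F.d a' b < F.d a b := by
  have h1 := (F.naturalParam_lt_iff ha ha').2 h
  have h2 := (F.naturalParam_lt_iff ha' hb).2 hab
  rw [d_eq, d_eq, ENNReal.ofReal_lt_ofReal_iff_of_nonneg (F.kl_nonneg (Subtype.mem _)
    (Subtype.mem _))]
  exact F.kl_lt_kl_left (Subtype.mem _) (Subtype.mem _) h1 h2

lemma d_le_d_left {a a' b : ℝ} (ha : a ∈ F.means) (ha' : a' ∈ F.means) (hb : b ∈ F.means)
    (h : a ≤ a') (hab : a' ≤ b) : F.d a' b ≤ F.d a b := by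
  rcases hab.eq_or_lt with rfl | hab
  · simp
  · rcases h.eq_or_lt with rfl | h
    · rfl
    · exact (F.d_lt_d_left ha ha' hb h hab).le

lemma d_le_d_right {a b b' : ℝ} (ha : a ∈ F.means) (hb : b ∈ F.means) (hb' : b' ∈ F.means)
    (h : a ≤ b) (hbb : b ≤ b') : F.d a b ≤ F.d a b' := by
  rw [d_eq, d_eq]
  exact ENNReal.ofReal_le_ofReal (F.kl_le_kl_right (Subtype.mem _) (Subtype.mem _) (Subtype.mem _)
    ((F.naturalParam_le_iff ha hb).2 h) ((F.naturalParam_le_iff hb hb').2 hbb))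

/-- Every mean is approached from the right by means, and the divergences converge. -/
lemma exists_seq_means_tendsto_d {c : ℝ} (hc : c ∈ F.means) :
    ∃ b : ℕ → ℝ, (∀ n, b n ∈ F.means ∧ c < b n) ∧
      ∀ a, Tendsto (fun n => F.d a (b n)) atTop (𝓝 (F.d a c)) := by
  obtain ⟨θ, hθ, rfl⟩ := hc
  obtain ⟨u, hu, hΘ⟩ := exists_Ico_subset_of_mem_nhds (F.isOpen_Θ.mem_nhds hθ) (exists_gt θ)
  obtain ⟨v, -, hv, hlim⟩ := exists_seq_strictAnti_tendsto' hu
  have hvΘ : ∀ n, v n ∈ F.Θ := fun n => hΘ ⟨(hv n).1.le, (hv n).2⟩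
  refine ⟨fun n => F.mean (v n), fun n => ⟨⟨v n, hvΘ n, rfl⟩,
    F.strictMonoOn_mean hθ (hvΘ n) (hv n).1⟩, fun a => ?_⟩
  simp only [d_eq, F.naturalParam_mean (hvΘ _), F.naturalParam_mean hθ]
  exact (ENNReal.continuous_ofReal.tendsto _).comp ((F.continuousAt_kl_right _ hθ).tendsto.comp hlim)

end ExpFamily

/-! ### Change of measure for adaptive sampling over a fixed number of slots -/

section Sampling

variable {K : ℕ}

lemma measurable_eval_comp {Ω : Type*} [MeasurableSpace Ω] {k : Ω → Fin K} (hk : Measurable k)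
    {X : Fin K → Ω → ℝ} (hX : ∀ j, Measurable (X j)) : Measurable (fun ω => X (k ω) ω) :=
  (measurable_from_prod_countable_right hX : Measurable fun p : Fin K × Ω => X p.1 p.2).comp
    (hk.prodMk measurable_id)

/-- The `σ`-algebra generated by all potential measurements of the first `t` slots. -/
@[reducible] def pastSigma (K t : ℕ) : MeasurableSpace (Outcome K) :=
  ⨆ p ∈ {p : ℕ × Fin K | p.1 < t}, MeasurableSpace.comap (fun ω : Outcome K => ω p) inferInstance

lemma pastSigma_mono {s t : ℕ} (h : s ≤ t) : pastSigma K s ≤ pastSigma K t :=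
  biSup_mono fun _ hp => lt_of_lt_of_le hp h

lemma measurable_eval_pastSigma {t : ℕ} {p : ℕ × Fin K} (hp : p.1 < t) :
    Measurable[pastSigma K t] (fun ω : Outcome K => ω p) :=
  measurable_iff_comap_le.2 (le_biSup
    (fun p : ℕ × Fin K => MeasurableSpace.comap (fun ω : Outcome K => ω p) inferInstance) hp)

/-- The law of independent measurements, those of slice `k` having law `ν k`. -/
noncomputable abbrev productLaw (ν : Fin K → Measure ℝ) : Measure (Outcome K) :=
  Measure.infinitePi (fun p : ℕ × Fin K => ν p.2)

namespace SamplingRule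

variable (S : SamplingRule K)

/-- The choice of slice is itself a function of earlier observations, hence the strong induction.
The larger `σ`-algebra is generated by fixed coordinates, so independence can be read off from it.
-/
lemma obsSigma_le_pastSigma (t : ℕ) : obsSigma S.slice t ≤ pastSigma K t := by
  induction t using Nat.strong_induction_on with
  | _ t ih =>
    refine iSup_le fun s => iSup_le fun hs => ?_
    have hk : Measurable[pastSigma K t] (S.slice s) :=
      (S.measurable_slice s).mono ((ih s hs).trans (pastSigma_mono hs.le)) le_rfl
    have hX : Measurable[pastSigma K t] (fun ω : Outcome K => ω (s, S.slice s ω)) :=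
      @measurable_eval_comp K _ (pastSigma K t) _ hk (fun j ω => ω (s, j))
        fun j => measurable_eval_pastSigma hs
    have hkX : Measurable[pastSigma K t]
        (fun ω : Outcome K => (S.slice s ω, ω (s, S.slice s ω))) := hk.prodMk hX
    exact measurable_iff_comap_le.1 hkX

lemma measurable_slice_pi (t : ℕ) : Measurable (S.slice t) :=
  (S.measurable_slice t).mono (S.obsSigma_le t) le_rfl

/-- The slice probed in slot `t + 1`, together with the measurement obtained. -/
def observation (t : ℕ) (ω : Outcome K) : Fin K × ℝ := (S.slice t ω, ω (t, S.slice t ω))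

lemma measurable_observation {s t : ℕ} (h : s < t) :
    Measurable[obsSigma S.slice t] (S.observation s) :=
  measurable_iff_comap_le.2 (le_iSup₂ (f := fun s (_ : s < t) => MeasurableSpace.comap
    (fun ω : Outcome K => (S.slice s ω, ω (s, S.slice s ω))) inferInstance) s h)

lemma obsSigma_mono {s t : ℕ} (h : s ≤ t) : obsSigma S.slice s ≤ obsSigma S.slice t :=
  S.filtration.mono h

/-- These rectangles, past event and new observation, form a `π`-system, so a change of measure need
only be checked on them. -/
lemma obsSigma_succ_eq_generateFrom (t : ℕ) :
    obsSigma S.slice (t + 1) = MeasurableSpace.generateFrom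
      {B | ∃ A D, MeasurableSet[obsSigma S.slice t] A ∧ MeasurableSet D ∧
        B = A ∩ S.observation t ⁻¹' D} := by
  refine le_antisymm (iSup_le fun s => iSup_le fun hs => ?_)
    (MeasurableSpace.generateFrom_le ?_)
  · rintro _ ⟨D, hD, rfl⟩
    refine MeasurableSpace.measurableSet_generateFrom ?_
    rcases (Nat.lt_succ_iff.1 hs).lt_or_eq with h | rfl
    · exact ⟨_, univ, S.measurable_observation h hD, .univ, by rw [preimage_univ, inter_univ]; rfl⟩
    · exact ⟨univ, D, @MeasurableSet.univ _ (_), hD, by rw [univ_inter]; rfl⟩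
  · rintro _ ⟨A, D, hA, hD, rfl⟩
    exact (S.obsSigma_mono t.le_succ _ hA).inter (S.measurable_observation t.lt_succ_self hD)

lemma isPiSystem_inter_observation (t : ℕ) :
    IsPiSystem {B | ∃ A D, MeasurableSet[obsSigma S.slice t] A ∧ MeasurableSet D ∧
        B = A ∩ S.observation t ⁻¹' D} := by
  rintro _ ⟨A, D, hA, hD, rfl⟩ _ ⟨A', D', hA', hD', rfl⟩ -
  exact ⟨A ∩ A', D ∩ D', hA.inter hA', hD.inter hD', by rw [preimage_inter, inter_inter_inter_comm]⟩

variable (ν : Fin K → Measure ℝ) [∀ k, IsProbabilityMeasure (ν k)]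

lemma indep_obsSigma_eval (t : ℕ) (k : Fin K) :
    Indep (obsSigma S.slice t) (MeasurableSpace.comap (fun ω : Outcome K => ω (t, k)) inferInstance)
      (productLaw ν) := by
  have h : iIndepFun (fun (p : ℕ × Fin K) (ω : Outcome K) => ω p) (productLaw ν) :=
    iIndepFun_infinitePi (P := fun p : ℕ × Fin K => ν p.2) (X := fun _ => id)
      fun _ => measurable_id
  have h2 := indep_iSup_of_disjoint (fun p => (measurable_pi_apply p).comap_le) h.iIndep
    (S := {p | p.1 < t}) (T := {(t, k)}) (by simp)
  refine indep_of_indep_of_le h2 (S.obsSigma_le_pastSigma t) ?_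
  simp

lemma map_eval_productLaw (t : ℕ) (k : Fin K) :
    (productLaw ν).map (fun ω : Outcome K => ω (t, k)) = ν k :=
  (measurePreserving_eval_infinitePi (fun p : ℕ × Fin K => ν p.2) (t, k)).map_eq

lemma setLIntegral_mul_eval (t : ℕ) (k : Fin K) {A : Set (Outcome K)}
    (hA : MeasurableSet[obsSigma S.slice t] A) {f : Outcome K → ℝ≥0∞}
    (hf : Measurable[obsSigma S.slice t] f) {g : ℝ → ℝ≥0∞} (hg : Measurable g) :
    ∫⁻ ω in A, f ω * g (ω (t, k)) ∂(productLaw ν)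
      = (∫⁻ ω in A, f ω ∂(productLaw ν)) * ∫⁻ x, g x ∂(ν k) := by
  have hA' : MeasurableSet A := S.obsSigma_le t _ hA
  have h := lintegral_mul_eq_lintegral_mul_lintegral_of_independent_measurableSpace
    (S.obsSigma_le t) (measurable_pi_apply (t, k)).comap_le (S.indep_obsSigma_eval ν t k)
    (hf.indicator hA) (hg.comp (comap_measurable (fun ω : Outcome K => ω (t, k))))
  simp only [Function.comp_apply] at h
  rw [lintegral_indicator hA', ← lintegral_map (g := fun ω : Outcome K => ω (t, k)) hg
    (measurable_pi_apply _), map_eval_productLaw] at h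
  rw [← h, ← lintegral_indicator hA']
  congr with ω
  by_cases hω : ω ∈ A <;> simp [hω]

variable {ν}

/-- Splitting by the probed slice turns the random coordinate of the observation into a fixed one,
which is independent of the past. -/
lemma measure_eq_sum_slice (m : Measure (Outcome K)) (t : ℕ) (B : Set (Outcome K)) :
    m B = ∑ k, m (B ∩ S.slice t ⁻¹' {k}) := by
  have h := sum_measure_preimage_singleton (μ := m.restrict B) Finset.univ
    (f := S.slice t) fun k _ => S.measurable_slice_pi t (measurableSet_singleton k)
  simp only [Finset.coe_univ, preimage_univ, Measure.restrict_apply_univ] at h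
  rw [← h]
  refine Finset.sum_congr rfl fun k _ => ?_
  rw [Measure.restrict_apply (S.measurable_slice_pi t (measurableSet_singleton k)), inter_comm]

variable (l : Fin K → ℝ → ℝ)

/-- The log-likelihood ratio of the observation of slot `t + 1`. -/
def increment (t : ℕ) (ω : Outcome K) : ℝ := l (S.slice t ω) (ω (t, S.slice t ω))

variable {l}

lemma measurable_increment
    (hl : ∀ k, Measurable (l k)) {s t : ℕ} (h : s < t) :
    Measurable[obsSigma S.slice t] (S.increment l s) :=
  (measurable_from_prod_countable_right hl : Measurable fun p : Fin K × ℝ => l p.1 p.2).comp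
    (S.measurable_observation h)


variable (l) in
/-- The likelihood ratio of the observations of the first `t` slots. -/
noncomputable def likelihood (t : ℕ) (ω : Outcome K) : ℝ≥0∞ :=
  ENNReal.ofReal (Real.exp (-∑ s ∈ Finset.range t, S.increment l s ω))

lemma measurable_likelihood
    (hl : ∀ k, Measurable (l k)) (t : ℕ) : Measurable[obsSigma S.slice t] (S.likelihood l t) := by
  have h : Measurable[obsSigma S.slice t] (fun ω => ∑ s ∈ Finset.range t, S.increment l s ω) :=
    Finset.measurable_sum _ fun s hs => S.measurable_increment hl (Finset.mem_range.1 hs)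
  have h2 : Measurable (fun x : ℝ => ENNReal.ofReal (Real.exp (-x))) := by fun_prop
  exact h2.comp h

lemma likelihood_succ (t : ℕ) (ω : Outcome K) :
    S.likelihood l (t + 1) ω
      = S.likelihood l t ω * ENNReal.ofReal (Real.exp (-S.increment l t ω)) := by
  rw [likelihood, likelihood, Finset.sum_range_succ, neg_add, Real.exp_add,
    ENNReal.ofReal_mul (Real.exp_nonneg _)]

variable {ν' : Fin K → Measure ℝ} [∀ k, IsProbabilityMeasure (ν' k)]

/-- Inductive step of the change of measure. Where slice `k` is probed, the rectangle is a past
event intersected with an event of the coordinate `(t, k)`. Both sides factorize by independence,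
and the new factor is the density of `ν' k`. -/
lemma measure_inter_observation
    (hl : ∀ k, Measurable (l k))
    (hν : ∀ k, ν' k = (ν k).withDensity (fun x => ENNReal.ofReal (Real.exp (-l k x)))) {t : ℕ}
    (ih : ∀ B, MeasurableSet[obsSigma S.slice t] B →
      productLaw ν' B = ∫⁻ ω in B, S.likelihood l t ω ∂(productLaw ν))
    {A : Set (Outcome K)} (hA : MeasurableSet[obsSigma S.slice t] A)
    {D : Set (Fin K × ℝ)} (hD : MeasurableSet D) :
    productLaw ν' (A ∩ S.observation t ⁻¹' D)
      = ∫⁻ ω in A ∩ S.observation t ⁻¹' D, S.likelihood l (t + 1) ω ∂(productLaw ν) := by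
  have hB : MeasurableSet (A ∩ S.observation t ⁻¹' D) :=
    (S.obsSigma_le t _ hA).inter
      (S.obsSigma_le (t + 1) _ (S.measurable_observation t.lt_succ_self hD))
  rw [← withDensity_apply _ hB, S.measure_eq_sum_slice _ t,
    S.measure_eq_sum_slice (Measure.withDensity _ _) t]
  refine Finset.sum_congr rfl fun k _ => ?_
  have hAk : MeasurableSet[obsSigma S.slice t] (A ∩ S.slice t ⁻¹' {k}) :=
    hA.inter (S.measurable_slice t (measurableSet_singleton k))
  have hDk : MeasurableSet (Prod.mk k ⁻¹' D : Set ℝ) := measurable_prodMk_left hD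
  have hXk : MeasurableSet ((fun ω : Outcome K => ω (t, k)) ⁻¹' (Prod.mk k ⁻¹' D)) :=
    measurable_pi_apply (t, k) hDk
  have heq : A ∩ S.observation t ⁻¹' D ∩ S.slice t ⁻¹' {k}
      = A ∩ S.slice t ⁻¹' {k} ∩ (fun ω : Outcome K => ω (t, k)) ⁻¹' (Prod.mk k ⁻¹' D) := by
    ext ω
    simp only [mem_inter_iff, mem_preimage, observation, mem_singleton_iff]
    constructor
    · rintro ⟨⟨h1, h2⟩, rfl⟩
      exact ⟨⟨h1, rfl⟩, h2⟩
    · rintro ⟨⟨h1, rfl⟩, h2⟩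
      exact ⟨⟨h1, h2⟩, rfl⟩
  have hg : Measurable (fun x => ENNReal.ofReal (Real.exp (-l k x))) :=
    (Real.measurable_exp.comp (hl k).neg).ennreal_ofReal
  have hmeas : MeasurableSet (A ∩ S.slice t ⁻¹' {k}) := S.obsSigma_le t _ hAk
  rw [heq, withDensity_apply _ (hmeas.inter hXk)]
  have h1 := S.setLIntegral_mul_eval ν' t k hAk (f := 1) measurable_const
    (g := (Prod.mk k ⁻¹' D).indicator 1) (measurable_one.indicator hDk)
  have h2 := S.setLIntegral_mul_eval ν t k hAk (S.measurable_likelihood hl t)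
    (hg.indicator hDk)
  have h3 : productLaw ν' (A ∩ S.slice t ⁻¹' {k} ∩
      (fun ω : Outcome K => ω (t, k)) ⁻¹' (Prod.mk k ⁻¹' D))
      = productLaw ν' (A ∩ S.slice t ⁻¹' {k}) * ν' k (Prod.mk k ⁻¹' D) := by
    rw [lintegral_indicator_one hDk] at h1
    simp only [Pi.one_apply, one_mul, setLIntegral_one] at h1
    rw [← h1, inter_comm, ← Measure.restrict_apply hXk, ← lintegral_indicator_one hXk]
    rfl
  rw [h3, ih _ hAk, hν k, withDensity_apply _ hDk, ← lintegral_indicator hDk, ← h2,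
    inter_comm (A ∩ S.slice t ⁻¹' {k}), ← setLIntegral_indicator hXk]
  refine setLIntegral_congr_fun hmeas fun ω hω => ?_
  obtain rfl : S.slice t ω = k := hω.2
  by_cases h : ω (t, S.slice t ω) ∈ Prod.mk (S.slice t ω) ⁻¹' D
  · rw [indicator_of_mem h, indicator_of_mem (by exact h), likelihood_succ]
    rfl
  · rw [indicator_of_notMem h, indicator_of_notMem (by exact h), mul_zero]

/-- Change of measure on the observations of the first `t` slots. -/
lemma measure_eq_setLIntegral_likelihood
    (hl : ∀ k, Measurable (l k))
    (hν : ∀ k, ν' k = (ν k).withDensity (fun x => ENNReal.ofReal (Real.exp (-l k x)))) (t : ℕ) {B : Set (Outcome K)}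
    (hB : MeasurableSet[obsSigma S.slice t] B) :
    productLaw ν' B = ∫⁻ ω in B, S.likelihood l t ω ∂(productLaw ν) := by
  induction t generalizing B with
  | zero =>
    have h0 : obsSigma S.slice 0 = ⊥ := by simp [obsSigma]
    rw [h0, MeasurableSpace.measurableSet_bot_iff] at hB
    rcases hB with rfl | rfl <;> simp [likelihood]
  | succ t ih =>
    have hle := S.obsSigma_le (t + 1)
    have hstep := fun {A} hA {D} hD => S.measure_inter_observation hl hν (fun B hB => ih hB)
      (A := A) hA (D := D) hD
    have hB' := hle _ hB
    -- Both measures are restricted to the observation `σ`-algebra, since the `π`-system generates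
    -- only that one.
    rw [← withDensity_apply _ hB', ← trim_measurableSet_eq hle hB,
      ← trim_measurableSet_eq hle hB]
    congr 1
    refine ext_of_generate_finite _ (S.obsSigma_succ_eq_generateFrom t)
      (S.isPiSystem_inter_observation t) ?_ ?_
    · rintro C ⟨A, D, hA, hD, rfl⟩
      have hC : MeasurableSet[obsSigma S.slice (t + 1)] (A ∩ S.observation t ⁻¹' D) :=
        (S.obsSigma_mono t.le_succ _ hA).inter (S.measurable_observation t.lt_succ_self hD)
      rw [trim_measurableSet_eq hle hC, trim_measurableSet_eq hle hC,
        withDensity_apply _ (hle _ hC)]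
      exact hstep hA hD
    · rw [trim_measurableSet_eq hle .univ, trim_measurableSet_eq hle .univ,
        withDensity_apply _ .univ]
      simpa using hstep (A := univ) .univ (D := univ) .univ

end SamplingRule

end Sampling

/-! ### Stopped log-likelihood ratios and the testing lower bound -/

section Stopping

variable {K : ℕ}

namespace SamplingRule

variable (S : SamplingRule K) {ν ν' : Fin K → Measure ℝ} [∀ k, IsProbabilityMeasure (ν k)]
  [∀ k, IsProbabilityMeasure (ν' k)] {l : Fin K → ℝ → ℝ}

variable (l) in
/-- The log-likelihood ratio of the observations made before time `σ`, for `σ` bounded by `n`. -/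
noncomputable def stoppedSum (σ : Outcome K → ℕ∞) (n : ℕ) (ω : Outcome K) : ℝ :=
  ∑ s ∈ Finset.range n, {ω | (s : ℕ∞) < σ ω}.indicator (S.increment l s) ω

/-- Indicators of `{s < σ}` keep every term of `stoppedSum` a past event times an increment, as
Wald's inequality needs. Here the sum is identified with the usual one on `{σ = t}`. -/
lemma stoppedSum_eq {σ : Outcome K → ℕ∞} {n t : ℕ} (htn : t ≤ n) {ω : Outcome K}
    (hω : σ ω = t) : S.stoppedSum l σ n ω = ∑ s ∈ Finset.range t, S.increment l s ω := by
  unfold stoppedSum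
  rw [← Finset.sum_subset (Finset.range_mono htn)]
  · refine Finset.sum_congr rfl fun s hs => indicator_of_mem ?_ _
    simpa [hω] using hs
  · intro s _ hs
    refine indicator_of_notMem ?_ _
    simpa [hω] using hs

lemma measurableSet_lt {σ : Outcome K → ℕ∞} (hσ : IsStoppingTime S.filtration σ) (s : ℕ) :
    MeasurableSet[obsSigma S.slice s] {ω | (s : ℕ∞) < σ ω} :=
  hσ.measurableSet_gt s

lemma measure_eq_sum_stopping (m : Measure (Outcome K)) {σ : Outcome K → ℕ∞}
    (hσ : IsStoppingTime S.filtration σ) {n : ℕ} (hn : ∀ ω, σ ω ≤ n) {B : Set (Outcome K)}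
    (hB : MeasurableSet B) :
    m B = ∑ t ∈ Finset.range (n + 1), m (B ∩ {ω | σ ω = t}) := by
  rw [← measure_biUnion_finset]
  · congr 1
    ext ω
    obtain ⟨t, ht⟩ := ENat.ne_top_iff_exists.1 (ne_top_of_le_ne_top (ENat.natCast_ne_top n) (hn ω))
    have htn : t ≤ n := by simpa [← ht] using hn ω
    simp only [mem_iUnion, mem_inter_iff, Finset.mem_range, mem_ofPred_eq, exists_prop]
    exact ⟨fun h => ⟨t, Nat.lt_succ_of_le htn, h, ht.symm⟩, fun ⟨_, _, h, _⟩ => h⟩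
  · intro s _ t _ hst
    refine disjoint_left.2 fun ω h1 h2 => hst ?_
    have h3 : σ ω = s := h1.2
    have h4 : σ ω = t := h2.2
    exact_mod_cast h3.symm.trans h4
  · intro t _
    exact hB.inter (S.obsSigma_le t _ (hσ.measurableSet_eq_of_countable t))

lemma measurable_increment_pi
    (hl : ∀ k, Measurable (l k)) (t : ℕ) : Measurable (S.increment l t) :=
  (S.measurable_increment hl t.lt_succ_self).mono (S.obsSigma_le (t + 1)) le_rfl

lemma measurable_stoppedSum
    (hl : ∀ k, Measurable (l k)) {σ : Outcome K → ℕ∞} (hσ : IsStoppingTime S.filtration σ) (n : ℕ) :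
    Measurable (S.stoppedSum l σ n) :=
  Finset.measurable_sum _ fun s _ => (S.measurable_increment_pi hl s).indicator
    (S.obsSigma_le s _ (S.measurableSet_lt hσ s))

/-- Change of measure on the observations made before a bounded stopping time. -/
lemma measure_eq_setLIntegral_stoppedSum
    (hl : ∀ k, Measurable (l k))
    (hν : ∀ k, ν' k = (ν k).withDensity (fun x => ENNReal.ofReal (Real.exp (-l k x)))) {σ : Outcome K → ℕ∞}
    (hσ : IsStoppingTime S.filtration σ) {n : ℕ} (hn : ∀ ω, σ ω ≤ n) {B : Set (Outcome K)}
    (hB : MeasurableSet[hσ.measurableSpace] B) :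
    productLaw ν' B
      = ∫⁻ ω in B, ENNReal.ofReal (Real.exp (-S.stoppedSum l σ n ω)) ∂(productLaw ν) := by
  have hB' : MeasurableSet B := hσ.measurableSpace_le _ hB
  rw [← withDensity_apply _ hB', S.measure_eq_sum_stopping _ hσ hn hB',
    S.measure_eq_sum_stopping (Measure.withDensity _ _) hσ hn hB']
  refine Finset.sum_congr rfl fun t ht => ?_
  have htn : t ≤ n := Nat.lt_succ_iff.1 (Finset.mem_range.1 ht)
  -- On `{σ = t}` an event known at time `σ` is known at time `t`, so the fixed-time change of
  -- measure applies.
  have hBt : MeasurableSet[obsSigma S.slice t] (B ∩ {ω | σ ω = t}) :=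
    (hσ.measurableSet_inter_eq_iff B t).1
      (hB.inter (hσ.measurableSet_eq_of_countable' t))
  have hBt' := S.obsSigma_le t _ hBt
  rw [withDensity_apply _ hBt', S.measure_eq_setLIntegral_likelihood hl hν t hBt]
  refine setLIntegral_congr_fun hBt' fun ω hω => ?_
  simp only [likelihood]
  rw [S.stoppedSum_eq htn hω.2]

lemma increment_eq_sum (t : ℕ) :
    S.increment l t = fun ω =>
      ∑ k, (S.slice t ⁻¹' {k}).indicator 1 ω * l k (ω (t, k)) := by
  ext ω
  rw [Finset.sum_eq_single (S.slice t ω)]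
  · simp [increment]
  · intro k _ hk
    rw [indicator_of_notMem (by simpa using hk.symm), zero_mul]
  · simp

lemma integrable_eval
    (hinteg : ∀ k, Integrable (l k) (ν k)) (t : ℕ) (k : Fin K) :
    Integrable (fun ω : Outcome K => l k (ω (t, k))) (productLaw ν) :=
  (measurePreserving_eval_infinitePi (fun p : ℕ × Fin K => ν p.2) (t, k)).integrable_comp_of_integrable
    (hinteg k)

lemma integrable_increment
    (hinteg : ∀ k, Integrable (l k) (ν k)) (t : ℕ) : Integrable (S.increment l t) (productLaw ν) := by
  rw [increment_eq_sum]
  refine integrable_finsetSum _ fun k _ => ?_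
  refine ((integrable_eval hinteg t k).indicator
    (S.measurable_slice_pi t (measurableSet_singleton k))).congr (ae_of_all _ fun ω => ?_)
  by_cases h : ω ∈ S.slice t ⁻¹' {k} <;> simp [h]

lemma integral_indicator_mul_eval
    (hl : ∀ k, Measurable (l k)) (t : ℕ) (k : Fin K) {A : Set (Outcome K)}
    (hA : MeasurableSet[obsSigma S.slice t] A) :
    ∫ ω, A.indicator 1 ω * l k (ω (t, k)) ∂(productLaw ν)
      = (productLaw ν).real A * ∫ x, l k x ∂(ν k) := by
  have hA' : MeasurableSet A := S.obsSigma_le t _ hA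
  have hm : Measurable[obsSigma S.slice t] (A.indicator (1 : Outcome K → ℝ)) :=
    Measurable.indicator (@measurable_const _ _ _ (obsSigma S.slice t) 1) hA
  have hind : IndepFun (A.indicator (1 : Outcome K → ℝ)) (fun ω : Outcome K => l k (ω (t, k)))
      (productLaw ν) := by
    refine indep_of_indep_of_le (S.indep_obsSigma_eval ν t k) hm.comap_le ?_
    exact ((hl k).comp (comap_measurable (fun ω : Outcome K => ω (t, k)))).comap_le
  have h := hind.integral_fun_mul_eq_mul_integral
    (measurable_one.indicator hA').aestronglyMeasurable
    ((hl k).comp (measurable_pi_apply (t, k))).aestronglyMeasurable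
  rw [h, integral_indicator_one hA']
  have hmap := integral_map (μ := productLaw ν) (φ := fun ω : Outcome K => ω (t, k))
    (measurable_pi_apply _).aemeasurable (hl k).aestronglyMeasurable
  rw [map_eval_productLaw] at hmap
  rw [hmap]

/-- The event and the probed slice are known before the slot, so each slice contributes the
probability of its part of `A` times its mean increment, at most `D`. -/
lemma setIntegral_increment_le
    (hl : ∀ k, Measurable (l k))
    (hinteg : ∀ k, Integrable (l k) (ν k)) {D : ℝ} (hD : ∀ k, ∫ x, l k x ∂(ν k) ≤ D) (t : ℕ)
    {A : Set (Outcome K)} (hA : MeasurableSet[obsSigma S.slice t] A) :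
    ∫ ω, A.indicator (S.increment l t) ω ∂(productLaw ν) ≤ D * (productLaw ν).real A := by
  have h1 : A.indicator (S.increment l t) = fun ω =>
      ∑ k, (A ∩ S.slice t ⁻¹' {k}).indicator 1 ω * l k (ω (t, k)) := by
    rw [increment_eq_sum]
    ext ω
    by_cases h : ω ∈ A
    · simp only [indicator_of_mem h]
      refine Finset.sum_congr rfl fun k _ => ?_
      by_cases h' : ω ∈ S.slice t ⁻¹' {k}
      · have h'' : ω ∈ A ∩ S.slice t ⁻¹' {k} := ⟨h, h'⟩
        rw [indicator_of_mem h', indicator_of_mem h'']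
      · rw [indicator_of_notMem h', indicator_of_notMem fun h'' => h' h''.2]
    · rw [indicator_of_notMem h, Finset.sum_eq_zero]
      intro k _
      rw [indicator_of_notMem fun h' => h h'.1, zero_mul]
  have hAk : ∀ k, MeasurableSet[obsSigma S.slice t] (A ∩ S.slice t ⁻¹' {k}) := fun k =>
    hA.inter (S.measurable_slice t (measurableSet_singleton k))
  rw [h1, integral_finsetSum]
  · have hsum : (productLaw ν).real A = ∑ k, (productLaw ν).real (A ∩ S.slice t ⁻¹' {k}) := by
      simp only [measureReal_def]
      rw [S.measure_eq_sum_slice _ t A, ENNReal.toReal_sum fun _ _ => measure_ne_top _ _]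
    rw [hsum, Finset.mul_sum]
    refine Finset.sum_le_sum fun k _ => ?_
    rw [S.integral_indicator_mul_eval hl t k (hAk k), mul_comm]
    exact mul_le_mul_of_nonneg_right (hD k) measureReal_nonneg
  · intro k _
    refine ((integrable_eval hinteg t k).indicator (S.obsSigma_le t _ (hAk k))).congr
      (ae_of_all _ fun ω => ?_)
    by_cases h : ω ∈ A ∩ S.slice t ⁻¹' {k} <;> simp [h]

lemma integrable_stoppedSum
    (hinteg : ∀ k, Integrable (l k) (ν k)) {σ : Outcome K → ℕ∞} (hσ : IsStoppingTime S.filtration σ) (n : ℕ) :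
    Integrable (S.stoppedSum l σ n) (productLaw ν) :=
  integrable_finsetSum _ fun s _ => (S.integrable_increment hinteg s).indicator
    (S.obsSigma_le s _ (S.measurableSet_lt hσ s))

/-- The indicators of `{s < σ}` for `s < n` add up to `min σ n`. -/
lemma sum_measure_lt_le_lintegral {σ : Outcome K → ℕ∞} (hσ : IsStoppingTime S.filtration σ)
    (m : Measure (Outcome K)) (n : ℕ) :
    ∑ s ∈ Finset.range n, m {ω | (s : ℕ∞) < σ ω} ≤ ∫⁻ ω, (σ ω : ℝ≥0∞) ∂m := by
  have hm : ∀ s : ℕ, MeasurableSet {ω | (s : ℕ∞) < σ ω} := fun s =>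
    S.obsSigma_le s _ (S.measurableSet_lt hσ s)
  simp_rw [← fun s => lintegral_indicator_one (μ := m) (hm s)]
  rw [← lintegral_finsetSum _ fun s _ => measurable_one.indicator (hm s)]
  refine lintegral_mono fun ω => ?_
  have h1 : ∀ s, {ω | (s : ℕ∞) < σ ω}.indicator (1 : Outcome K → ℝ≥0∞) ω
      = if (s : ℕ∞) < σ ω then 1 else 0 := fun s => by
    simp [indicator_apply]
  simp only [h1]
  rcases eq_or_ne (σ ω) ⊤ with h | h
  · simp [h]
  · obtain ⟨t, ht⟩ := ENat.ne_top_iff_exists.1 h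
    rw [← ht, Finset.sum_ite, Finset.sum_const_zero, add_zero, Finset.sum_const, nsmul_one]
    simp only [Nat.cast_lt, ENat.toENNReal_coe]
    have hsub : (Finset.range n).filter (· < t) ⊆ Finset.range t := fun s hs => by
      simpa using (Finset.mem_filter.1 hs).2
    exact_mod_cast (Finset.card_le_card hsub).trans_eq (Finset.card_range t)

/-- Wald's inequality for the log-likelihood ratio. -/
lemma integral_stoppedSum_le
    (hl : ∀ k, Measurable (l k))
    (hinteg : ∀ k, Integrable (l k) (ν k)) {σ : Outcome K → ℕ∞} (hσ : IsStoppingTime S.filtration σ) (n : ℕ)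
    {D : ℝ} (hD0 : 0 ≤ D) (hD : ∀ k, ∫ x, l k x ∂(ν k) ≤ D)
    (hfin : ∫⁻ ω, (σ ω : ℝ≥0∞) ∂(productLaw ν) ≠ ∞) :
    ∫ ω, S.stoppedSum l σ n ω ∂(productLaw ν)
      ≤ D * (∫⁻ ω, (σ ω : ℝ≥0∞) ∂(productLaw ν)).toReal := by
  unfold stoppedSum
  rw [integral_finsetSum _ fun s _ => (S.integrable_increment hinteg s).indicator
    (S.obsSigma_le s _ (S.measurableSet_lt hσ s))]
  calc _ ≤ ∑ s ∈ Finset.range n, D * (productLaw ν).real {ω | (s : ℕ∞) < σ ω} :=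
        Finset.sum_le_sum fun s _ =>
          S.setIntegral_increment_le hl hinteg hD s (S.measurableSet_lt hσ s)
    _ = D * (∑ s ∈ Finset.range n, productLaw ν {ω | (s : ℕ∞) < σ ω}).toReal := by
        rw [← Finset.mul_sum, ENNReal.toReal_sum fun _ _ => measure_ne_top _ _]
        rfl
    _ ≤ _ := by
        gcongr
        exact S.sum_measure_lt_le_lintegral hσ _ n

/-- The variational lower bound on the expected log-likelihood ratio, for a test function that
takes the value `-a` on the event `B` and `a` on its complement. -/
lemma le_integral_stoppedSum
    (hl : ∀ k, Measurable (l k))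
    (hν : ∀ k, ν' k = (ν k).withDensity (fun x => ENNReal.ofReal (Real.exp (-l k x))))
    (hinteg : ∀ k, Integrable (l k) (ν k)) {σ : Outcome K → ℕ∞}
    (hσ : IsStoppingTime S.filtration σ) {n : ℕ} (hn : ∀ ω, σ ω ≤ n) {B : Set (Outcome K)}
    (hB : MeasurableSet[hσ.measurableSpace] B) (a : ℝ) :
    a * (1 - 2 * (productLaw ν).real B) + 1
        - (Real.exp (-a) * (productLaw ν').real B
          + Real.exp a * (1 - (productLaw ν').real B))
      ≤ ∫ ω, S.stoppedSum l σ n ω ∂(productLaw ν) := by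
  classical
  have hB' : MeasurableSet B := hσ.measurableSpace_le _ hB
  set L := S.stoppedSum l σ n with hL
  have hLm : Measurable L := S.measurable_stoppedSum hl hσ n
  have hLi : Integrable L (productLaw ν) := S.integrable_stoppedSum hinteg hσ n
  -- The integral of `exp (-L)` over an event known at time `σ` is its probability under `ν'`.
  have hexp : ∀ C, MeasurableSet[hσ.measurableSpace] C →
      IntegrableOn (fun ω => Real.exp (-L ω)) C (productLaw ν) ∧
      ∫ ω in C, Real.exp (-L ω) ∂(productLaw ν) = (productLaw ν').real C := by
    intro C hC
    have h := S.measure_eq_setLIntegral_stoppedSum hl hν hσ hn hC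
    have hnn : 0 ≤ᵐ[(productLaw ν).restrict C] fun ω => Real.exp (-L ω) :=
      ae_of_all _ fun _ => Real.exp_nonneg _
    have hm : AEStronglyMeasurable (fun ω => Real.exp (-L ω)) ((productLaw ν).restrict C) :=
      (Real.measurable_exp.comp hLm.neg).aestronglyMeasurable
    refine ⟨⟨hm, ?_⟩, ?_⟩
    · rw [hasFiniteIntegral_iff_ofReal hnn, ← h]
      exact measure_lt_top _ _
    · rw [integral_eq_lintegral_of_nonneg_ae hnn hm, ← h]
      rfl
  have hBi := hexp B hB
  have hBc := hexp Bᶜ hB.compl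
  rw [probReal_compl_eq_one_sub hB'] at hBc
  -- The inequality `1 + x ≤ exp x` at `x = -a - L` on `B`, and below at `x = a - L` on the
  -- complement.
  have h1 : ∫ ω in B, (1 + -a - L ω) ∂(productLaw ν)
      ≤ ∫ ω in B, Real.exp (-a) * Real.exp (-L ω) ∂(productLaw ν) := by
    refine integral_mono ((integrable_const _).sub hLi.integrableOn) (hBi.1.const_mul _) fun ω => ?_
    have := Real.add_one_le_exp (-a + -L ω)
    simp only [← Real.exp_add]
    linarith
  have h2 : ∫ ω in Bᶜ, (1 + a - L ω) ∂(productLaw ν)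
      ≤ ∫ ω in Bᶜ, Real.exp a * Real.exp (-L ω) ∂(productLaw ν) := by
    refine integral_mono ((integrable_const _).sub hLi.integrableOn) (hBc.1.const_mul _) fun ω => ?_
    have := Real.add_one_le_exp (a + -L ω)
    simp only [← Real.exp_add]
    linarith
  rw [integral_const_mul, hBi.2, integral_sub (integrable_const _) hLi.integrableOn,
    setIntegral_const, smul_eq_mul] at h1
  rw [integral_const_mul, hBc.2, integral_sub (integrable_const _) hLi.integrableOn,
    setIntegral_const, smul_eq_mul, probReal_compl_eq_one_sub hB'] at h2
  rw [← integral_add_compl hB' hLi]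
  linarith

/-- Lower bound on an expected stopping time that permits a test of `ν` against `ν'` with both
error probabilities at most `δ`. -/
lemma mul_log_le_mul_lintegral
    (hl : ∀ k, Measurable (l k))
    (hν : ∀ k, ν' k = (ν k).withDensity (fun x => ENNReal.ofReal (Real.exp (-l k x))))
    (hinteg : ∀ k, Integrable (l k) (ν k)) {τ : Outcome K → ℕ∞} (hτ : IsStoppingTime S.filtration τ)
    {E : Set (Outcome K)} (hE : MeasurableSet[hτ.measurableSpace] E) {δ : ℝ} (hδ0 : 0 < δ)
    (hδ : δ ≤ 1 / 2) (hEν : (productLaw ν).real E ≤ δ) (hEν' : 1 - δ ≤ (productLaw ν').real E)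
    (hτ' : ∀ᵐ ω ∂(productLaw ν'), τ ω < ⊤) {D : ℝ} (hD0 : 0 ≤ D)
    (hD : ∀ k, ∫ x, l k x ∂(ν k) ≤ D) (hfin : ∫⁻ ω, (τ ω : ℝ≥0∞) ∂(productLaw ν) ≠ ∞) :
    (1 - 2 * δ) * Real.log ((1 - δ) / δ)
      ≤ D * (∫⁻ ω, (τ ω : ℝ≥0∞) ∂(productLaw ν)).toReal := by
  -- With this `a`, the exponential terms of the variational bound add up to exactly `1` when the
  -- event has `ν'`-probability `1 - δ`, which cancels the `+ 1`.
  set a := Real.log ((1 - δ) / δ) with ha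
  have hpos : 0 < (1 - δ) / δ := div_pos (by linarith) hδ0
  have ha0 : 0 ≤ a := Real.log_nonneg (by rw [le_div_iff₀ hδ0]; linarith)
  have hexp : Real.exp a = (1 - δ) / δ := Real.exp_log hpos
  have hexpn : Real.exp (-a) = δ / (1 - δ) := by rw [Real.exp_neg, hexp, inv_div]
  have hE' : MeasurableSet E := hτ.measurableSpace_le _ hE
  have hbound : ∀ n : ℕ, a * (1 - 2 * δ) + 1
      - (Real.exp (-a) * (productLaw ν').real (E ∩ {ω | τ ω ≤ n})
        + Real.exp a * (1 - (productLaw ν').real (E ∩ {ω | τ ω ≤ n})))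
      ≤ D * (∫⁻ ω, (τ ω : ℝ≥0∞) ∂(productLaw ν)).toReal := by
    intro n
    -- Truncation at `n` gives a bounded stopping time. Intersecting `E` with `{τ ≤ n}` makes it an
    -- event known at that time, and only lowers its `ν`-probability.
    have hσ := hτ.min_const n
    have hle : ∫⁻ ω, ((min (τ ω) (n : ℕ∞) : ℕ∞) : ℝ≥0∞) ∂(productLaw ν)
        ≤ ∫⁻ ω, (τ ω : ℝ≥0∞) ∂(productLaw ν) :=
      lintegral_mono fun ω => ENat.toENNReal_le.2 (min_le_left _ _)
    have hEn : MeasurableSet[hσ.measurableSpace] (E ∩ {ω | τ ω ≤ n}) :=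
      (hτ.measurableSet_inter_le_const_iff E n).1 (hE.inter (hτ.measurableSet_le' n))
    have h1 := S.le_integral_stoppedSum hl hν hinteg hσ (n := n) (fun ω => min_le_right _ _) hEn a
    have h2 := S.integral_stoppedSum_le hl hinteg hσ n hD0 hD (ne_top_of_le_ne_top hfin hle)
    have h3 : (productLaw ν).real (E ∩ {ω | τ ω ≤ n}) ≤ δ :=
      (measureReal_mono inter_subset_left).trans hEν
    have h4 : a * (1 - 2 * δ) ≤ a * (1 - 2 * (productLaw ν).real (E ∩ {ω | τ ω ≤ n})) := by
      gcongr
    have h5 := mul_le_mul_of_nonneg_left (ENNReal.toReal_mono hfin hle) hD0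
    exact (sub_le_sub_right (by linarith) _).trans (h1.trans (h2.trans h5))
  -- Almost sure finiteness of `τ` under `ν'` ensures that truncation loses no `ν'`-probability in
  -- the limit.
  have hlim : Tendsto (fun n : ℕ => (productLaw ν').real (E ∩ {ω | τ ω ≤ n})) atTop
      (𝓝 ((productLaw ν').real E)) := by
    have hmono : Monotone fun n : ℕ => E ∩ {ω | τ ω ≤ n} := fun n m hnm ω hω =>
      ⟨hω.1, le_trans (b := (n : ℕ∞)) hω.2 (Nat.cast_le.2 hnm)⟩
    have hae : productLaw ν' (⋃ n : ℕ, E ∩ {ω | τ ω ≤ n}) = productLaw ν' E := by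
      refine measure_congr ?_
      filter_upwards [hτ'] with ω hω
      refine propext ⟨fun h => ?_, fun h => ?_⟩
      · obtain ⟨n, hn⟩ := mem_iUnion.1 h
        exact hn.1
      · obtain ⟨t, ht⟩ := ENat.ne_top_iff_exists.1 hω.ne
        exact mem_iUnion.2 ⟨t, h, ht.symm.le⟩
    have h := tendsto_measure_iUnion_atTop (μ := productLaw ν') hmono
    rw [hae] at h
    exact (ENNReal.tendsto_toReal (measure_ne_top _ _)).comp h
  have hfinal := le_of_tendsto (((tendsto_const_nhds (x := a * (1 - 2 * δ) + 1)).sub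
    ((hlim.const_mul (Real.exp (-a))).add ((hlim.const_sub 1).const_mul (Real.exp a)))))
    (Eventually.of_forall hbound)
  set q := (productLaw ν').real E
  -- The left side is nonincreasing in `q` and equals `1` at `q = 1 - δ`.
  have hq : Real.exp (-a) * q + Real.exp a * (1 - q) ≤ 1 := by
    have h1 : Real.exp (-a) ≤ Real.exp a := Real.exp_le_exp.2 (by linarith)
    have h2 : Real.exp (-a) * (1 - δ) = δ := by
      rw [hexpn]; exact div_mul_cancel₀ _ (by linarith)
    have h3 : Real.exp a * δ = 1 - δ := by
      rw [hexp]; exact div_mul_cancel₀ _ hδ0.ne'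
    nlinarith [mul_nonneg (sub_nonneg.2 h1) (sub_nonneg.2 hEν')]
  linarith

end SamplingRule

end Stopping

/-! ### Bernoulli divergence -/

lemma lintegral_bernoulliMeasure (p : unitInterval) (f : ℕ → ℝ≥0∞) :
    ∫⁻ n, f n ∂(bernoulliMeasure (1 : ℕ) 0 p)
      = ENNReal.ofReal p * f 1 + ENNReal.ofReal (1 - p) * f 0 := by
  have h : ∀ q : unitInterval, ((unitInterval.toNNReal q : NNReal) : ℝ≥0∞) = ENNReal.ofReal q :=
    fun q => by rw [← ENNReal.ofReal_coe_nnreal]; rfl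
  rw [bernoulliMeasure_def, lintegral_add_measure, lintegral_smul_measure, lintegral_smul_measure,
    lintegral_dirac, lintegral_dirac, ENNReal.smul_def, ENNReal.smul_def, h, h,
    unitInterval.coe_symm_eq, smul_eq_mul, smul_eq_mul]

/-- The closed form identifies the constant of the testing bound with `d_B(δ, 1 - δ)`. The density
`g` takes the two likelihood ratios as values. -/
lemma dB_symm_eq {δ : unitInterval} (hδ0 : 0 < (δ : ℝ)) (hδ1 : (δ : ℝ) < 1) :
    dB δ (unitInterval.symm δ)
      = ENNReal.ofReal ((1 - 2 * δ) * Real.log ((1 - δ) / δ)) := by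
  have h1δ : 0 < 1 - (δ : ℝ) := by linarith
  set g : ℕ → ℝ≥0∞ := fun n =>
    if n = 1 then ENNReal.ofReal (δ / (1 - δ)) else ENNReal.ofReal ((1 - δ) / δ) with hg
  have hgm : Measurable g := measurable_from_top
  have hdens : bernoulliMeasure (1 : ℕ) 0 δ
      = (bernoulliMeasure (1 : ℕ) 0 (unitInterval.symm δ)).withDensity g := by
    ext s hs
    rw [withDensity_apply _ hs, ← lintegral_indicator hs, lintegral_bernoulliMeasure,
      ← lintegral_indicator_one hs, lintegral_bernoulliMeasure, unitInterval.coe_symm_eq]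
    have e1 : ENNReal.ofReal (1 - δ) * ENNReal.ofReal (δ / (1 - δ)) = ENNReal.ofReal δ := by
      rw [← ENNReal.ofReal_mul h1δ.le, mul_div_cancel₀ _ h1δ.ne']
    have e0 : ENNReal.ofReal δ * ENNReal.ofReal ((1 - δ) / δ) = ENNReal.ofReal (1 - δ) := by
      rw [← ENNReal.ofReal_mul hδ0.le, mul_div_cancel₀ _ hδ0.ne']
    by_cases m1 : (1 : ℕ) ∈ s <;> by_cases m0 : (0 : ℕ) ∈ s <;> simp [m1, m0, hg, e1, e0]
  have hac : bernoulliMeasure (1 : ℕ) 0 δ ≪ bernoulliMeasure (1 : ℕ) 0 (unitInterval.symm δ) :=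
    hdens ▸ withDensity_absolutelyContinuous _ _
  have hrn := Measure.rnDeriv_withDensity (bernoulliMeasure (1 : ℕ) 0 (unitInterval.symm δ)) hgm
  rw [← hdens] at hrn
  rw [dB, klDiv_eq_lintegral_klFun_of_ac hac, lintegral_congr_ae (g := fun n =>
    ENNReal.ofReal (klFun (g n).toReal)) (hrn.mono fun n hn => by simp only [hn]),
    lintegral_bernoulliMeasure, unitInterval.coe_symm_eq]
  have hp : 0 < (δ : ℝ) / (1 - δ) := div_pos hδ0 h1δ
  have hp' : 0 < (1 - (δ : ℝ)) / δ := div_pos h1δ hδ0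
  simp only [hg, if_true, zero_ne_one, if_false, ENNReal.toReal_ofReal hp.le,
    ENNReal.toReal_ofReal hp'.le, sub_sub_cancel]
  rw [← ENNReal.ofReal_mul h1δ.le, ← ENNReal.ofReal_mul hδ0.le,
    ← ENNReal.ofReal_add (mul_nonneg h1δ.le (klFun_nonneg hp.le))
      (mul_nonneg hδ0.le (klFun_nonneg hp'.le))]
  congr 1
  have hlog : Real.log (δ / (1 - δ)) = -Real.log ((1 - δ) / δ) := by
    rw [← Real.log_inv, inv_div]
  rw [klFun_apply, klFun_apply, hlog]
  field_simp
  ring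

lemma indicator_mem_stdSimplex {K : ℕ} (k : Fin K) :
    (fun j => if j = k then (1 : ℝ) else 0) ∈ stdSimplex ℝ (Fin K) :=
  ⟨fun j => by beta_reduce; split_ifs <;> norm_num, by simp⟩

/-! ### The max-min problem -/

section Objective

variable {F : ExpFamily} {K : ℕ} [NeZero K] {γ : ℝ} {μ : Fin K → ℝ}

lemma minLoad_le (μ : Fin K → ℝ) (k : Fin K) : minLoad μ ≤ μ k :=
  Finset.inf'_le _ (Finset.mem_univ k)

lemma exists_eq_minLoad (μ : Fin K → ℝ) : ∃ k, μ k = minLoad μ := by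
  obtain ⟨k, -, hk⟩ := Finset.exists_mem_eq_inf' (Finset.univ_nonempty (α := Fin K)) μ
  exact ⟨k, hk.symm⟩

lemma minLoad_mem_means (hμ : ∀ k, μ k ∈ F.means) : minLoad μ ∈ F.means := by
  obtain ⟨k, hk⟩ := exists_eq_minLoad μ
  exact hk ▸ hμ k

lemma minLoad_lt_of_correct_ne (hC : correct γ μ ≠ {0}) : minLoad μ < γ := by
  by_contra h
  refine hC (ext fun a => ?_)
  simp [correct, h]

lemma succ_mem_correct_iff {k : Fin K} : k.succ ∈ correct γ μ ↔ μ k < γ := by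
  simp only [correct, mem_ofPred_eq, Fin.succ_ne_zero, and_false, or_false]
  constructor
  · rintro ⟨-, j, hj, hlt⟩
    rwa [Fin.succ_injective _ hj]
  · exact fun h => ⟨(minLoad_le μ k).trans_lt h, k, rfl, h⟩

lemma correct_eq_image (h : minLoad μ < γ) : correct γ μ = Fin.succ '' {k | μ k < γ} := by
  ext a
  simp only [correct, mem_ofPred_eq, h, true_and, not_true, false_and, or_false, mem_image]
  exact ⟨fun ⟨k, hk, hlt⟩ => ⟨k, hlt, hk.symm⟩, fun ⟨k, hlt, hk⟩ => ⟨k, hk.symm, hlt⟩⟩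

/-- The information against the closest alternative in which an available slice is not
available. -/
lemma iInf_information_eq (hγ : γ ∈ F.means) (hμ : ∀ j, μ j ∈ F.means) (w : Fin K → ℝ)
    {k : Fin K} (hk : μ k < γ) :
    ⨅ l ∈ {l ∈ instances F K γ | k.succ ∉ correct γ l}, information F w μ l
      = ENNReal.ofReal (w k) * F.d (μ k) γ := by
  refine le_antisymm ?_ (le_iInf₂ fun l hl => ?_)
  · obtain ⟨b, hb, hlim⟩ := F.exists_seq_means_tendsto_d hγ
    -- Besides slice `k`, the slices with load exactly `γ` are raised to `b n`. Otherwise the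
    -- smallest load could equal `γ`, which is excluded. Their cost vanishes in the limit because
    -- `d(γ, γ) = 0`.
    have hT : Tendsto (fun n => information F w μ
        (fun j => if j = k ∨ μ j = γ then b n else μ j)) atTop
        (𝓝 (∑ j, ENNReal.ofReal (w j) * if j = k ∨ μ j = γ then F.d (μ j) γ else 0)) := by
      refine tendsto_finsetSum _ fun j _ => ENNReal.Tendsto.const_mul ?_
        (Or.inr ENNReal.ofReal_ne_top)
      by_cases hj : j = k ∨ μ j = γ
      · simp only [if_pos hj]
        exact hlim _
      · simp [if_neg hj]
    have hsum : ∑ j, ENNReal.ofReal (w j) * (if j = k ∨ μ j = γ then F.d (μ j) γ else 0)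
        = ENNReal.ofReal (w k) * F.d (μ k) γ := by
      rw [Finset.sum_eq_single k]
      · simp
      · intro j _ hj
        by_cases h : μ j = γ <;> simp [hj, h]
      · simp
    rw [hsum] at hT
    refine ge_of_tendsto' hT fun n => iInf₂_le _ ⟨⟨fun j => ?_, ?_⟩, ?_⟩
    · beta_reduce
      split_ifs
      exacts [(hb n).1, hμ j]
    · obtain ⟨j, hj⟩ := exists_eq_minLoad (fun j => if j = k ∨ μ j = γ then b n else μ j)
      rw [← hj]
      split_ifs with h
      exacts [(hb n).2.ne', fun h' => h (Or.inr h')]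
    · rw [succ_mem_correct_iff]
      simpa using (hb n).2.le
  · have hlk : γ ≤ l k := not_lt.1 fun h => hl.2 (succ_mem_correct_iff.2 h)
    calc _ ≤ ENNReal.ofReal (w k) * F.d (μ k) (l k) := by
          gcongr
          exact F.d_le_d_right (hμ k) hγ (hl.1.1 k) hk.le hlk
      _ ≤ _ := Finset.single_le_sum (f := fun j => ENNReal.ofReal (w j) * F.d (μ j) (l j))
          (fun _ _ => zero_le) (Finset.mem_univ k)

lemma objective_eq (hγ : γ ∈ F.means) (hμ : ∀ j, μ j ∈ F.means) (h : minLoad μ < γ)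
    (w : Fin K → ℝ) :
    objective F γ μ w = ⨆ k ∈ {k | μ k < γ}, ENNReal.ofReal (w k) * F.d (μ k) γ := by
  unfold objective
  rw [correct_eq_image h, iSup_image]
  exact iSup_congr fun k => iSup_congr fun hk => iInf_information_eq hγ hμ w hk

lemma d_le_d_minLoad (hγ : γ ∈ F.means) (hμ : ∀ j, μ j ∈ F.means) {k : Fin K} (hk : μ k ≤ γ) :
    F.d (μ k) γ ≤ F.d (minLoad μ) γ :=
  F.d_le_d_left (minLoad_mem_means hμ) (hμ k) hγ (minLoad_le μ k) hk

lemma objective_le (hγ : γ ∈ F.means) (hμ : ∀ j, μ j ∈ F.means) (h : minLoad μ < γ)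
    {w : Fin K → ℝ} (hw : w ∈ stdSimplex ℝ (Fin K)) :
    objective F γ μ w ≤ F.d (minLoad μ) γ := by
  rw [objective_eq hγ hμ h]
  refine iSup₂_le fun k hk => ?_
  calc _ ≤ 1 * F.d (minLoad μ) γ := by
        gcongr
        · exact ENNReal.ofReal_le_one.2 (mem_Icc_of_mem_stdSimplex hw k).2
        · exact d_le_d_minLoad hγ hμ (le_of_lt hk)
    _ = _ := one_mul _

lemma objective_single (hγ : γ ∈ F.means) (hμ : ∀ j, μ j ∈ F.means) (h : minLoad μ < γ)
    {k : Fin K} (hk : μ k = minLoad μ) :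
    objective F γ μ (fun j => if j = k then 1 else 0) = F.d (minLoad μ) γ := by
  refine le_antisymm (objective_le hγ hμ h (indicator_mem_stdSimplex k)) ?_
  rw [objective_eq hγ hμ h]
  refine le_iSup₂_of_le k (hk.trans_lt h) ?_
  simp [hk]

/-- Some available slice must attain the bound. Strict monotonicity of `d(·, γ)` forces its load to
be minimal, and then `0 < d(μ_⋆, γ) < ∞` forces its weight to be one. -/
lemma exists_eq_single_of_le_objective (hγ : γ ∈ F.means) (hμ : ∀ j, μ j ∈ F.means)
    (h : minLoad μ < γ) {w : Fin K → ℝ} (hw : w ∈ stdSimplex ℝ (Fin K))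
    (hle : F.d (minLoad μ) γ ≤ objective F γ μ w) :
    ∃ k, μ k = minLoad μ ∧ w = fun j => if j = k then 1 else 0 := by
  have hpos := F.d_pos (minLoad_mem_means hμ) hγ h
  obtain ⟨k, hk, hkle⟩ : ∃ k, μ k < γ ∧
      F.d (minLoad μ) γ ≤ ENNReal.ofReal (w k) * F.d (μ k) γ := by
    by_contra! hcon
    refine hle.not_gt ?_
    rw [objective_eq hγ hμ h]
    -- A finite supremum of terms strictly below a positive bound is strictly below it; positivity
    -- covers the empty supremum.
    refine lt_of_le_of_lt (iSup_le fun k => ?_)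
      ((Finset.sup_lt_iff (s := Finset.univ.filter fun k => μ k < γ)
        (f := fun k => ENNReal.ofReal (w k) * F.d (μ k) γ) hpos).2
        fun k hk => hcon k (Finset.mem_filter.1 hk).2)
    exact iSup_le fun hk => Finset.le_sup (f := fun k => ENNReal.ofReal (w k) * F.d (μ k) γ)
      (Finset.mem_filter.2 ⟨Finset.mem_univ k, hk⟩)
  have hw1 := (mem_Icc_of_mem_stdSimplex hw k).2
  have hmin : μ k = minLoad μ := by
    by_contra hne
    have hlt := F.d_lt_d_left (minLoad_mem_means hμ) (hμ k) hγ
      (lt_of_le_of_ne (minLoad_le μ k) (Ne.symm hne)) hk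
    have : ENNReal.ofReal (w k) * F.d (μ k) γ ≤ 1 * F.d (μ k) γ := by
      gcongr
      exact ENNReal.ofReal_le_one.2 hw1
    rw [one_mul] at this
    exact (hkle.trans this).not_gt hlt
  rw [hmin] at hkle
  have hwk : w k = 1 := by
    refine le_antisymm hw1 (not_lt.1 fun hlt => hkle.not_gt ?_)
    calc _ < 1 * F.d (minLoad μ) γ :=
          (ENNReal.mul_lt_mul_iff_left hpos.ne' (F.d_ne_top _ _)).2 (ENNReal.ofReal_lt_one.2 hlt)
      _ = _ := one_mul _
  refine ⟨k, hmin, funext fun j => ?_⟩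
  split_ifs with hj
  · rw [hj, hwk]
  · have hsum := hw.2
    rw [← Finset.add_sum_erase _ _ (Finset.mem_univ k), hwk, add_eq_left,
      Finset.sum_eq_zero_iff_of_nonneg fun i _ => hw.1 i] at hsum
    exact hsum j (Finset.mem_erase.2 ⟨hj, Finset.mem_univ j⟩)

end Objective

/-! ### The lower bound on the expected number of measurements -/

section LowerBound

variable {F : ExpFamily} {K : ℕ} [NeZero K] {γ δ : ℝ} {μ : Fin K → ℝ}

lemma Algorithm.IsPC.mul_log_le {A : Algorithm K} (hA : A.IsPC F γ δ) (hδ0 : 0 < δ)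
    (hδ : δ ≤ 1 / 2) (hμ : μ ∈ instances F K γ) (h : minLoad μ < γ) {b : ℝ} (hb : b ∈ F.means)
    (hγb : γ < b) (hfin : A.expectedCost F μ ≠ ∞) :
    (1 - 2 * δ) * Real.log ((1 - δ) / δ)
      ≤ (F.d (minLoad μ) b).toReal * (A.expectedCost F μ).toReal := by
  -- In this alternative all loads exceed `γ`, and slices with load at least `b` are unchanged, so
  -- probing them yields no information.
  set m : Fin K → ℝ := fun k => max (μ k) b with hm
  have hmm : ∀ k, m k ∈ F.means := fun k => by
    rcases max_choice (μ k) b with h' | h'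
    · exact (congrArg (· ∈ F.means) h').mpr (hμ.1 k)
    · exact (congrArg (· ∈ F.means) h').mpr hb
  have hmmin : γ < minLoad m := by
    obtain ⟨k, hk⟩ := exists_eq_minLoad m
    exact hk ▸ hγb.trans_le (le_max_right _ _)
  obtain ⟨hfinite, herr⟩ := hA m ⟨hmm, hmmin.ne'⟩
  obtain ⟨-, herrμ⟩ := hA μ hμ
  -- Rejection is an error under `μ` and the only correct decision under `m`.
  let E : Set (Outcome K) := A.decision ⁻¹' {0}
  have hE : MeasurableSet[A.isStoppingTime_τ.measurableSpace] E :=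
    A.measurable_decision (measurableSet_singleton 0)
  have hE' : MeasurableSet E := A.isStoppingTime_τ.measurableSpace_le _ hE
  refine A.toSamplingRule.mul_log_le_mul_lintegral (ν := fun k => F.law (μ k))
    (ν' := fun k => F.law (m k))
    (l := fun k => F.logRatio (F.naturalParam (μ k)) (F.naturalParam (m k)))
    (fun k => F.measurable_logRatio _ _)
    (fun k => F.member_eq_withDensity (Subtype.mem _) (Subtype.mem _))
    (fun k => F.integrable_logRatio (Subtype.mem _) _) A.isStoppingTime_τ hE hδ0 hδ ?_ ?_ hfinite
    ENNReal.toReal_nonneg (fun k => ?_) hfin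
  · refine ENNReal.toReal_le_of_le_ofReal hδ0.le (le_trans (measure_mono fun ω hω => ?_) herrμ)
    have hω0 : A.decision ω = 0 := hω
    simp [hω0, correct, h, (Fin.succ_ne_zero _).symm]
  · have hc : (productLaw fun k => F.law (m k)).real Eᶜ ≤ δ := by
      refine ENNReal.toReal_le_of_le_ofReal hδ0.le (le_trans (measure_mono fun ω hω => ?_) herr)
      have hω0 : A.decision ω ≠ 0 := hω
      simpa [correct, hmmin.not_gt] using hω0
    rw [probReal_compl_eq_one_sub hE'] at hc
    linarith
  · have hinteg : ∫ x, F.logRatio (F.naturalParam (μ k)) (F.naturalParam (m k)) x ∂(F.law (μ k))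
        = (F.d (μ k) (m k)).toReal := by
      rw [F.d_eq, ENNReal.toReal_ofReal (F.kl_nonneg (Subtype.mem _) (Subtype.mem _))]
      exact F.integral_logRatio (Subtype.mem _) _
    rw [hinteg]
    refine ENNReal.toReal_mono (F.d_ne_top _ _) ?_
    rcases le_total (μ k) b with hk | hk
    · simp only [hm, max_eq_right hk]
      exact F.d_le_d_left (minLoad_mem_means hμ.1) (hμ.1 k) hb (minLoad_le μ k) hk
    · simp [hm, max_eq_left hk]

lemma Algorithm.IsPC.ofReal_mul_log_le {A : Algorithm K} (hA : A.IsPC F γ δ) (hδ0 : 0 < δ)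
    (hδ : δ ≤ 1 / 2) (hγ : γ ∈ F.means) (hμ : μ ∈ instances F K γ) (h : minLoad μ < γ) :
    ENNReal.ofReal ((1 - 2 * δ) * Real.log ((1 - δ) / δ))
      ≤ F.d (minLoad μ) γ * A.expectedCost F μ := by
  -- Infinite cost is treated apart because its `toReal` is `0`; the right side is then infinite
  -- since `d(μ_⋆, γ) > 0`. Otherwise `b` decreases to `γ`.
  rcases eq_or_ne (A.expectedCost F μ) ∞ with hfin | hfin
  · rw [hfin, ENNReal.mul_top (F.d_pos (minLoad_mem_means hμ.1) hγ h).ne']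
    exact le_top
  · obtain ⟨b, hb, hlim⟩ := F.exists_seq_means_tendsto_d hγ
    have hl := ENNReal.Tendsto.mul_const (hlim (minLoad μ))
      (Or.inr hfin : F.d (minLoad μ) γ ≠ 0 ∨ A.expectedCost F μ ≠ ∞)
    refine ge_of_tendsto' hl fun n => ?_
    have := ENNReal.ofReal_le_ofReal (hA.mul_log_le hδ0 hδ hμ h (hb n).1 (hb n).2 hfin)
    rwa [ENNReal.ofReal_mul ENNReal.toReal_nonneg, ENNReal.ofReal_toReal (F.d_ne_top _ _),
      ENNReal.ofReal_toReal hfin] at this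

end LowerBound

end Admission

/-- The lower bound on the expected number of measurements for the any-available-slice criterion
with an available slice (the constant is the inverse of the value of the max-min problem), and the
solutions of the max-min problem: all measurements on one least loaded slice. -/
theorem proposition2 (F : Admission.ExpFamily) (K : ℕ) [NeZero K] (γ : ℝ) (hγ : γ ∈ F.means)
    (δ : unitInterval) (hδ0 : 0 < δ) (hδ : (δ : ℝ) ≤ 1 / 2)
    (μ : Fin K → ℝ) (hμ : μ ∈ Admission.instances F K γ) (hC : Admission.correct γ μ ≠ {0}) :
    (∀ A : Admission.Algorithm K, A.IsPC F γ δ →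
      (F.d (Admission.minLoad μ) γ)⁻¹ * Admission.dB δ (unitInterval.symm δ)
        ≤ A.expectedCost F μ) ∧
    Admission.maxMinValue F γ μ = F.d (Admission.minLoad μ) γ ∧
    Admission.optimalProportions F γ μ =
      {w | ∃ k : Fin K, μ k = Admission.minLoad μ ∧ w = fun j => if j = k then 1 else 0} := by
  have h := Admission.minLoad_lt_of_correct_ne hC
  have hpos := F.d_pos (Admission.minLoad_mem_means hμ.1) hγ h
  obtain ⟨k₀, hk₀⟩ := Admission.exists_eq_minLoad μ
  refine ⟨fun A hA => ?_, le_antisymm ?_ ?_, Set.ext fun w => ⟨fun hw => ?_, ?_⟩⟩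
  · have hδ0' : 0 < (δ : ℝ) := hδ0
    rw [Admission.dB_symm_eq hδ0' (by linarith), mul_comm (F.d _ _)⁻¹, ← div_eq_mul_inv]
    refine ENNReal.div_le_of_le_mul ?_
    rw [mul_comm (A.expectedCost F μ)]
    exact hA.ofReal_mul_log_le hδ0' hδ hγ hμ h
  · exact iSup₂_le fun w hw => Admission.objective_le hγ hμ.1 h hw
  · rw [← Admission.objective_single hγ hμ.1 h hk₀]
    exact le_iSup₂ (f := fun w (_ : w ∈ stdSimplex ℝ (Fin K)) => Admission.objective F γ μ w)
      _ (Admission.indicator_mem_stdSimplex k₀)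
  · refine Admission.exists_eq_single_of_le_objective hγ hμ.1 h hw.1 ?_
    rw [← Admission.objective_single hγ hμ.1 h hk₀]
    exact hw.2 (Admission.indicator_mem_stdSimplex k₀)
  · rintro ⟨k, hk, rfl⟩
    refine ⟨Admission.indicator_mem_stdSimplex k, fun w hw => ?_⟩
    simp only [Set.mem_ofPred_eq]
    rw [Admission.objective_single hγ hμ.1 h hk]
    exact Admission.objective_le hγ hμ.1 h hw
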